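/- For real numbers $\lambda_1\le\dots\le\lambda_s$, the Gelfand–Tsetlin polytope $GZ(\lambda_1\dots\lambda_s)\subset\mathbb R^{s(s-1)/2}$ is the set of all points $(u_{i,j})_{1\le i\le s-1,\ 1\le j\le s-i}$ such that $u_{i-1,j}\le u_{i,j}\le u_{i-1,j+1}$ for all $1\le i\le s-1$ and $1\le j\le s-i$, where $u_{0,j}:=\lambda_j$. For an $n$-dimensional convex polytope $P$ let $f_i$ be the number of its $i$-dimensional faces ($P$ itself being its only $n$-dimensional face), let $f(t)=\sum_{i=0}^n f_i t^i$, and define the $h$-vector $(h_0,\dots,h_n)$ of $P$ by $\sum_{i=0}^n h_i s^i=f(s-1)$. **Theorem.** Let $k\ge 1$, and let $GZ(1\,2^k\,3)$ be the Gelfand–Tsetlin polytope of the sequence $1,2,\dots,2,3$ with $k$ twos. It has dimension $2k+1$, and the components of its $h$-vector are $$h_{2k+1}=1,\qquad h_i=\begin{cases} i+1, & 0\le i\le k+1,\\ 2k+3-i, & k+1<i\le 2k.\end{cases}$$ -/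

import Mathlib

/-- Positions `(i, j)` of the coordinates `u_{i,j}` in the triangular table whose top row has
`s` entries: `1 ≤ i ≤ s - 1` and `1 ≤ j ≤ s - i`. There are `s (s - 1) / 2` of them. -/
def GZIndex (s : ℕ) : Type :=
  {p : ℕ × ℕ // 1 ≤ p.1 ∧ 1 ≤ p.2 ∧ p.1 + p.2 ≤ s}

instance GZIndex.instFinite (s : ℕ) : Finite (GZIndex s) := by
  have h : Set.Finite {p : ℕ × ℕ | 1 ≤ p.1 ∧ 1 ≤ p.2 ∧ p.1 + p.2 ≤ s} :=
    ((Set.finite_Iic s).prod (Set.finite_Iic s)).subset (by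
      rintro ⟨a, b⟩ ⟨h1, h2, h3⟩
      simp only [Set.mem_prod, Set.mem_Iic]
      omega)
  exact h.to_subtype

/-- The entry at place `j` (counted from `1`) of row `i` of the triangular table; row `0` is the
given sequence `lam 0, …, lam (s - 1)` and row `i ≥ 1` consists of the coordinates `u_{i,j}`. -/
def gzEntry {s : ℕ} (lam : Fin s → ℝ) (u : GZIndex s → ℝ) (i j : ℕ)
    (hj : 1 ≤ j) (hij : i + j ≤ s) : ℝ :=
  if hi : i = 0 then lam ⟨j - 1, by omega⟩
  else u ⟨(i, j), Nat.one_le_iff_ne_zero.mpr hi, hj, hij⟩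

/-- The Gelfand–Tsetlin polytope of the sequence `lam`: every entry below the top row lies between
its two upper neighbours. -/
def gelfandTsetlin {s : ℕ} (lam : Fin s → ℝ) : Set (GZIndex s → ℝ) :=
  {u | ∀ (i j : ℕ) (hi : 1 ≤ i) (hj : 1 ≤ j) (hij : i + j ≤ s),
    gzEntry lam u (i - 1) j hj (by omega) ≤ u ⟨(i, j), hi, hj, hij⟩ ∧
    u ⟨(i, j), hi, hj, hij⟩ ≤ gzEntry lam u (i - 1) (j + 1) (by omega) (by omega)}

/-- The sequence `1, 2, …, 2, 3` with exactly `k` twos. -/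
def seqOneTwosThree (k : ℕ) : Fin (k + 2) → ℝ :=
  fun j => if j = 0 then 1 else if j = Fin.last (k + 1) then 3 else 2

section Polytope

/-- The (affine) dimension of a nonempty set: the dimension of the direction of its affine hull. -/
noncomputable def affineDim {E : Type*} [AddCommGroup E] [Module ℝ E] (P : Set E) : ℕ :=
  Module.finrank ℝ (vectorSpan ℝ P)

/-- The number of `i`-dimensional faces of `P` (`P` itself is a face; a proper face is cut out by a
supporting hyperplane). -/
noncomputable def faceNumber {E : Type*} [AddCommGroup E] [Module ℝ E] [TopologicalSpace E]
    (P : Set E) (i : ℕ) : ℕ :=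
  Set.ncard {F : Set E | IsExposed ℝ P F ∧ F.Nonempty ∧ affineDim F = i}

open Polynomial in
/-- The polynomial `f(t) = f_0 + f_1 t + ⋯ + f_n t ^ n`, where `n = dim P`. -/
noncomputable def fPolynomial {E : Type*} [AddCommGroup E] [Module ℝ E] [TopologicalSpace E]
    (P : Set E) : ℤ[X] :=
  ∑ i ∈ Finset.range (affineDim P + 1), C (faceNumber P i : ℤ) * X ^ i

open Polynomial in
/-- The polynomial `h(s) = f(s - 1)`. -/
noncomputable def hPolynomial {E : Type*} [AddCommGroup E] [Module ℝ E] [TopologicalSpace E]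
    (P : Set E) : ℤ[X] :=
  (fPolynomial P).comp (X - 1)

/-- The component `h_i` of the `h`-vector, i.e. the coefficient of `s ^ i` in `h(s)`. -/
noncomputable def hVector {E : Type*} [AddCommGroup E] [Module ℝ E] [TopologicalSpace E]
    (P : Set E) (i : ℕ) : ℤ :=
  (hPolynomial P).coeff i

end Polytope

/-! In a table of `GZ(1 2^k 3)` every entry off the two slanted edges is squeezed to 2. What remains
is a chain rising from 1 to at most 2 on the left, a chain falling from 3 to at least 2 on the
right, and the bottom entry between the two chain ends. The gaps in these inequalities are 2k+4
nonnegative slacks: x_1..x_k and a on the left, y_1..y_k and b on the right, and c, d on either side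
of the bottom entry. They satisfy Σx + a = 1, Σy + b = 1 and c + d = a + b. The affine maps
`slackMap` and `tableMap` identify the two polytopes, hence their faces.

Nonempty faces of {w ≥ 0, Aw = b} correspond to supports of its points, and the dimension of a face
is the nullity of A on its support. Here supports are easy to list (`isSupport_slackSystem_iff`),
and the nullity is the size of the support minus 3, or minus 2 when a, b, c, d all vanish, since the
third relation is then void (`finrank_coordinateKernel_slackSystem`).

Summing over supports gives X^3 f(X) in closed form. Putting X - 1 for X and cancelling X - 1 leaves
(X - 1)^2 h(X), whose coefficients are the second differences of the h-vector; `slackH_generating`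
compares them with those of the claimed piecewise linear sequence. -/

/-! ### Faces of a polyhedron in standard form, encoded by supports. -/

section StandardForm

variable {M N : Type*} [AddCommGroup N] [Module ℝ N]

/-- The polyhedron of nonnegative solutions of the linear system `A w = b`. -/
def nonnegSolutions (A : (M → ℝ) →ₗ[ℝ] N) (b : N) : Set (M → ℝ) :=
  {w | (∀ m, 0 ≤ w m) ∧ A w = b}

/-- The nonnegative solutions of `A w = b` that vanish outside `S`. -/
def coordinateFace (A : (M → ℝ) →ₗ[ℝ] N) (b : N) (S : Finset M) : Set (M → ℝ) :=
  {w | w ∈ nonnegSolutions A b ∧ ∀ m, m ∉ S → w m = 0}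

/-- `S` is the support of some nonnegative solution of `A w = b`. -/
def IsSupport (A : (M → ℝ) →ₗ[ℝ] N) (b : N) (S : Finset M) : Prop :=
  ∃ w ∈ nonnegSolutions A b, ∀ m, 0 < w m ↔ m ∈ S

/-- The solutions of `A d = 0` that vanish outside `S`. -/
def coordinateKernel (A : (M → ℝ) →ₗ[ℝ] N) (S : Finset M) : Submodule ℝ (M → ℝ) where
  carrier := {d | A d = 0 ∧ ∀ m, m ∉ S → d m = 0}
  add_mem' := by
    rintro x y ⟨hx, hx'⟩ ⟨hy, hy'⟩
    exact ⟨by rw [map_add, hx, hy, add_zero], fun m hm => by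
      rw [Pi.add_apply, hx' m hm, hy' m hm, add_zero]⟩
  zero_mem' := ⟨map_zero A, fun _ _ => rfl⟩
  smul_mem' := by
    rintro c x ⟨hx, hx'⟩
    exact ⟨by rw [map_smul, hx, smul_zero], fun m hm => by
      rw [Pi.smul_apply, hx' m hm, smul_zero]⟩

variable {A : (M → ℝ) →ₗ[ℝ] N} {b : N}

lemma mem_coordinateFace_of_pos_iff {S : Finset M} {w : M → ℝ} (hw : w ∈ nonnegSolutions A b)
    (hS : ∀ m, 0 < w m ↔ m ∈ S) : w ∈ coordinateFace A b S :=
  ⟨hw, fun m hm => le_antisymm (not_lt.mp fun h => hm ((hS m).mp h)) (hw.1 m)⟩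

lemma convex_nonnegSolutions (A : (M → ℝ) →ₗ[ℝ] N) (b : N) :
    Convex ℝ (nonnegSolutions A b) := by
  rintro x ⟨hx, hx'⟩ y ⟨hy, hy'⟩ s t hs ht hst
  refine ⟨fun m => ?_, ?_⟩
  · have := mul_nonneg hs (hx m)
    have := mul_nonneg ht (hy m)
    simp only [Pi.add_apply, Pi.smul_apply, smul_eq_mul]
    linarith
  · rw [map_add, map_smul, map_smul, hx', hy', ← add_smul, hst, one_smul]

lemma subset_of_coordinateFace_subset {S T : Finset M} (hS : IsSupport A b S)
    (h : coordinateFace A b S ⊆ coordinateFace A b T) : S ⊆ T := by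
  obtain ⟨w, hw, hwS⟩ := hS
  intro m hm
  by_contra hmT
  have h0 := (h (mem_coordinateFace_of_pos_iff hw hwS)).2 m hmT
  exact absurd ((hwS m).mpr hm) (by simp [h0])

lemma coordinateFace_injOn : Set.InjOn (coordinateFace A b) {S | IsSupport A b S} :=
  fun _ hS _ hT h => Finset.Subset.antisymm (subset_of_coordinateFace_subset hS h.le)
    (subset_of_coordinateFace_subset hT h.ge)

variable [Fintype M]

/-- Minus the sum of the coordinates outside S is at most 0 on the polyhedron. The point with
support S attains 0, so the maximizers are exactly the points vanishing outside S. -/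
lemma isExposed_coordinateFace {S : Finset M} (hS : IsSupport A b S) :
    IsExposed ℝ (nonnegSolutions A b) (coordinateFace A b S) := by
  classical
  obtain ⟨w, hw, hwS⟩ := hS
  have hwF := mem_coordinateFace_of_pos_iff hw hwS
  intro _
  refine ⟨-∑ m ∈ Sᶜ, ContinuousLinearMap.proj (R := ℝ) (φ := fun _ : M => ℝ) m, ?_⟩
  ext x
  simp only [neg_apply, sum_apply,
    ContinuousLinearMap.proj_apply, neg_le_neg_iff, Set.mem_ofPred_eq]
  constructor
  · rintro ⟨hx, hx0⟩
    refine ⟨hx, fun y hy => ?_⟩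
    rw [Finset.sum_eq_zero fun m hm => hx0 m (Finset.mem_compl.mp hm)]
    exact Finset.sum_nonneg fun m _ => hy.1 m
  · rintro ⟨hx, hmin⟩
    refine ⟨hx, fun m hm => ?_⟩
    have h1 := hmin w hw
    rw [Finset.sum_eq_zero fun m hm => hwF.2 m (Finset.mem_compl.mp hm)] at h1
    have h2 := Finset.sum_nonneg fun m (_ : m ∈ Sᶜ) => hx.1 m
    exact (Finset.sum_eq_zero_iff_of_nonneg fun m _ => hx.1 m).mp (le_antisymm h1 h2) m
      (Finset.mem_compl.mpr hm)

/-- A small perturbation of a solution with support `S` along a direction that vanishes outside `S`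
is still nonnegative. -/
lemma exists_pos_add_smul_mem {S : Finset M} {w d : M → ℝ} (hw : w ∈ nonnegSolutions A b)
    (hwS : ∀ m, 0 < w m ↔ m ∈ S) (hd : d ∈ coordinateKernel A S) :
    ∃ ε : ℝ, 0 < ε ∧ w + ε • d ∈ coordinateFace A b S := by
  have hwF := mem_coordinateFace_of_pos_iff hw hwS
  have key : ∀ m, ∀ᶠ ε : ℝ in nhdsWithin 0 (Set.Ioi 0), 0 ≤ w m + ε * d m := by
    intro m
    by_cases hm : m ∈ S
    · have hc : Filter.Tendsto (fun ε : ℝ => w m + ε * d m) (nhds 0) (nhds (w m + 0 * d m)) :=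
        Continuous.tendsto (by fun_prop) 0
      have hpos : 0 < w m + 0 * d m := by simpa using (hwS m).mpr hm
      exact ((hc.eventually (lt_mem_nhds hpos)).filter_mono nhdsWithin_le_nhds).mono
        fun _ h => h.le
    · simp [hwF.2 m hm, hd.2 m hm]
  obtain ⟨ε, hε, hε0⟩ :=
    ((Filter.eventually_all.mpr key).and self_mem_nhdsWithin).exists
  refine ⟨ε, hε0, ⟨hε, ?_⟩, fun m hm => ?_⟩
  · rw [map_add, map_smul, hd.1, smul_zero, add_zero, hw.2]
  · simp [hwF.2 m hm, hd.2 m hm]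

/-- S is the union of the supports of the points of F. Convexity gives one point w of F with support
S, and w can be pushed slightly away from any v supported in S; a functional maximal at w is then
maximal at v too. -/
lemma exists_isSupport_of_isExposed {F : Set (M → ℝ)}
    (hF : IsExposed ℝ (nonnegSolutions A b) F) (hne : F.Nonempty) :
    ∃ S, IsSupport A b S ∧ F = coordinateFace A b S := by
  classical
  have hsub := hF.subset
  have hconv := hF.convex (convex_nonnegSolutions A b)
  obtain ⟨l, hl⟩ := hF hne
  let S : Finset M := Finset.univ.filter fun m => ∃ w ∈ F, 0 < w m
  have hS : ∀ m, m ∈ S ↔ ∃ w ∈ F, 0 < w m := fun m => by simp [S]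
  -- Midpoints of points of F accumulate the supports one coordinate at a time.
  have key : ∀ T : Finset M, T ⊆ S → ∃ w ∈ F, ∀ m ∈ T, 0 < w m := by
    intro T
    induction T using Finset.induction_on with
    | empty => exact fun _ => ⟨hne.some, hne.some_mem, by simp⟩
    | insert m T _ ih =>
      intro hT
      obtain ⟨w, hw, hwT⟩ := ih ((Finset.subset_insert _ _).trans hT)
      obtain ⟨v, hv, hvm⟩ := (hS m).mp (hT (Finset.mem_insert_self _ _))
      refine ⟨_, hconv hw hv (by norm_num : (0 : ℝ) ≤ 1 / 2) (by norm_num : (0 : ℝ) ≤ 1 / 2)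
        (by norm_num), fun n hn => ?_⟩
      have h1 := (hsub hw).1 n
      have h2 := (hsub hv).1 n
      simp only [Pi.add_apply, Pi.smul_apply, smul_eq_mul]
      rcases Finset.mem_insert.mp hn with rfl | hn
      · linarith
      · linarith [hwT n hn]
  obtain ⟨w, hw, hwS⟩ := key S subset_rfl
  have hwS' : ∀ m, 0 < w m ↔ m ∈ S := fun m => ⟨fun h => (hS m).mpr ⟨w, hw, h⟩, hwS m⟩
  refine ⟨S, ⟨w, hsub hw, hwS'⟩, Set.Subset.antisymm ?_ ?_⟩
  · refine fun v hv => ⟨hsub hv, fun m hm => le_antisymm ?_ ((hsub hv).1 m)⟩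
    exact not_lt.mp fun h => hm ((hS m).mpr ⟨v, hv, h⟩)
  · intro v hv
    have hd : w - v ∈ coordinateKernel A S :=
      ⟨by rw [map_sub, (hsub hw).2, hv.1.2, sub_self], fun m hm => by
        rw [Pi.sub_apply, hv.2 m hm, sub_zero]
        exact (mem_coordinateFace_of_pos_iff (hsub hw) hwS').2 m hm⟩
    -- The point w + ε(w - v) lies in the polyhedron, so l (w - v) ≤ 0.
    obtain ⟨ε, hε, hmem⟩ := exists_pos_add_smul_mem (hsub hw) hwS' hd
    rw [hl] at hw ⊢
    refine ⟨hv.1, fun y hy => (hw.2 y hy).trans ?_⟩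
    have h1 := hw.2 _ hmem.1
    rw [map_add, map_smul, map_sub, smul_eq_mul] at h1
    have h2 : ε * (l w - l v) ≤ 0 := by linarith
    nlinarith

lemma vectorSpan_coordinateFace {S : Finset M} (hS : IsSupport A b S) :
    vectorSpan ℝ (coordinateFace A b S) = coordinateKernel A S := by
  obtain ⟨w, hw, hwS⟩ := hS
  have hwF := mem_coordinateFace_of_pos_iff hw hwS
  apply le_antisymm
  · rw [vectorSpan_def, Submodule.span_le]
    rintro _ ⟨x, hx, y, hy, rfl⟩
    refine ⟨?_, fun m hm => ?_⟩
    · simp only [vsub_eq_sub]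
      rw [map_sub, hx.1.2, hy.1.2, sub_self]
    · simp [hx.2 m hm, hy.2 m hm]
  · intro d hd
    obtain ⟨ε, hε, hmem⟩ := exists_pos_add_smul_mem hw hwS hd
    have h := vsub_mem_vectorSpan ℝ hmem hwF
    rw [vsub_eq_sub, add_sub_cancel_left] at h
    exact (Submodule.smul_mem_iff _ hε.ne').mp h

/-- Rank-nullity for the map Φ that joins A to the restriction to the complement of S. It is onto:
extend prescribed values by zero, then correct the image under A by a vector supported in S. -/
lemma finrank_coordinateKernel_add [FiniteDimensional ℝ N] {S : Finset M}
    (hsurj : ∀ n, ∃ d, A d = n ∧ ∀ m, m ∉ S → d m = 0) :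
    Module.finrank ℝ (coordinateKernel A S) + Module.finrank ℝ N = S.card := by
  classical
  let Φ : (M → ℝ) →ₗ[ℝ] ({m // m ∉ S} → ℝ) × N :=
    (LinearMap.funLeft ℝ ℝ (Subtype.val : {m // m ∉ S} → M)).prod A
  have hker : LinearMap.ker Φ = coordinateKernel A S := by
    ext d
    constructor
    · intro hd
      have hd' : Φ d = 0 := hd
      exact ⟨congrArg Prod.snd hd', fun m hm => congrFun (congrArg Prod.fst hd') ⟨m, hm⟩⟩
    · rintro ⟨h1, h2⟩
      exact Prod.ext (funext fun m => h2 m m.2) h1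
  have hΦ : Function.Surjective Φ := by
    rintro ⟨g, n⟩
    let d₁ : M → ℝ := fun m => if hm : m ∉ S then g ⟨m, hm⟩ else 0
    obtain ⟨d₂, hd₂, hd₂'⟩ := hsurj (n - A d₁)
    refine ⟨d₁ + d₂, Prod.ext (funext fun m => ?_) ?_⟩
    · change d₁ m + d₂ m = g m
      rw [hd₂' m m.2, add_zero]
      exact dif_pos m.2
    · change A (d₁ + d₂) = n
      rw [map_add, hd₂, add_sub_cancel]
  have hrank := Φ.finrank_range_add_finrank_ker
  rw [LinearMap.range_eq_top.mpr hΦ, finrank_top, hker, Module.finrank_prod,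
    Module.finrank_fintype_fun_eq_card, Module.finrank_fintype_fun_eq_card,
    Fintype.card_subtype_compl, Fintype.card_coe] at hrank
  have := S.card_le_univ
  omega

lemma faceNumber_nonnegSolutions (i : ℕ) :
    faceNumber (nonnegSolutions A b) i =
      Set.ncard {S | IsSupport A b S ∧ Module.finrank ℝ (coordinateKernel A S) = i} := by
  rw [← (coordinateFace_injOn.mono fun S hS => hS.1).ncard_image]
  refine congrArg Set.ncard (Set.ext fun F => ⟨?_, ?_⟩)
  · rintro ⟨hF, hne, hdim⟩
    obtain ⟨S, hS, rfl⟩ := exists_isSupport_of_isExposed hF hne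
    refine ⟨S, ⟨hS, ?_⟩, rfl⟩
    rw [← hdim, affineDim, vectorSpan_coordinateFace hS]
  · rintro ⟨S, ⟨hS, hdim⟩, rfl⟩
    refine ⟨isExposed_coordinateFace hS, ?_, ?_⟩
    · obtain ⟨w, hw, hwS⟩ := hS
      exact ⟨w, mem_coordinateFace_of_pos_iff hw hwS⟩
    · rw [← hdim, affineDim, vectorSpan_coordinateFace hS]

lemma affineDim_nonnegSolutions (h : IsSupport A b Finset.univ) :
    affineDim (nonnegSolutions A b) =
      Module.finrank ℝ (coordinateKernel A (Finset.univ : Finset M)) := by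
  rw [← vectorSpan_coordinateFace h, affineDim]
  have : coordinateFace A b Finset.univ = nonnegSolutions A b := by
    ext w
    simp [coordinateFace]
  rw [this]

end StandardForm

/-! ### Transfer of faces and dimensions along affine maps. -/

section AffineTransfer

variable {E E' : Type*} [AddCommGroup E] [Module ℝ E] [TopologicalSpace E]
  [AddCommGroup E'] [Module ℝ E'] [TopologicalSpace E'] [IsTopologicalAddGroup E']
  [ContinuousSMul ℝ E'] [T2Space E'] [FiniteDimensional ℝ E']

lemma affineDim_image_le {V W : Type*} [AddCommGroup V] [Module ℝ V] [AddCommGroup W]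
    [Module ℝ W] [FiniteDimensional ℝ V] (f : V →ᵃ[ℝ] W) (s : Set V) :
    affineDim (f '' s) ≤ affineDim s := by
  unfold affineDim
  rw [← AffineMap.map_vectorSpan]
  exact Submodule.finrank_map_le _ _

lemma affineDim_image_eq {V W : Type*} [AddCommGroup V] [Module ℝ V] [AddCommGroup W]
    [Module ℝ W] [FiniteDimensional ℝ V] [FiniteDimensional ℝ W]
    (f : V →ᵃ[ℝ] W) (g : W →ᵃ[ℝ] V) {s : Set V} (h : Set.LeftInvOn g f s) :
    affineDim (f '' s) = affineDim s := by
  refine le_antisymm (affineDim_image_le f s) ?_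
  conv_lhs => rw [← h.image_image]
  exact affineDim_image_le g _

/-- The exposing functional is pulled back along the linear part of g; the constant `l (g 0)` does
not affect maximizers. Inverses on P and Q suffice, so the ambient spaces may have different
dimensions. -/
lemma IsExposed.image_of_invOn {P : Set E} {Q : Set E'} (f : E →ᵃ[ℝ] E') (g : E' →ᵃ[ℝ] E)
    (hf : Set.MapsTo f P Q) (hg : Set.MapsTo g Q P) (h : Set.InvOn g f P Q)
    {F : Set E} (hF : IsExposed ℝ P F) : IsExposed ℝ Q (f '' F) := by
  rintro ⟨_, x₀, hx₀, rfl⟩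
  have hsub := hF.subset
  obtain ⟨l, hl⟩ := hF ⟨x₀, hx₀⟩
  let l' : E' →L[ℝ] ℝ := LinearMap.toContinuousLinearMap (l.toLinearMap.comp g.linear)
  have hl' : ∀ y, l (g y) = l' y + l (g 0) := by
    intro y
    have := congrFun g.decomp y
    simp only [Pi.add_apply] at this
    rw [this, map_add]
    rfl
  refine ⟨l', Set.ext fun y => ⟨?_, ?_⟩⟩
  · rintro ⟨x, hx, rfl⟩
    refine ⟨hf (hsub hx), fun z hz => ?_⟩
    rw [hl] at hx
    have h1 := hx.2 (g z) (hg hz)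
    have h2 := hl' (f x)
    rw [h.1 hx.1] at h2
    linarith [hl' z]
  · rintro ⟨hy, hmax⟩
    refine ⟨g y, ?_, h.2 hy⟩
    rw [hl]
    refine ⟨hg hy, fun x hx => ?_⟩
    have h1 := hmax (f x) (hf hx)
    have h2 := hl' (f x)
    rw [h.1 hx] at h2
    linarith [hl' y]

variable [IsTopologicalAddGroup E] [ContinuousSMul ℝ E] [T2Space E] [FiniteDimensional ℝ E]

lemma faceNumber_eq_of_invOn {P : Set E} {Q : Set E'} (f : E →ᵃ[ℝ] E') (g : E' →ᵃ[ℝ] E)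
    (hf : Set.MapsTo f P Q) (hg : Set.MapsTo g Q P) (h : Set.InvOn g f P Q) (i : ℕ) :
    faceNumber P i = faceNumber Q i := by
  refine Set.ncard_congr (fun F _ => f '' F) ?_ ?_ ?_
  · rintro F ⟨hF, hne, hdim⟩
    refine ⟨hF.image_of_invOn f g hf hg h, hne.image f, ?_⟩
    rw [← hdim, affineDim_image_eq f g (h.1.mono hF.subset)]
  · rintro F G ⟨hF, -, -⟩ ⟨hG, -, -⟩ hFG
    rw [← (h.1.mono hF.subset).image_image, ← (h.1.mono hG.subset).image_image, hFG]
  · rintro G ⟨hG, hne, hdim⟩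
    refine ⟨g '' G, ⟨hG.image_of_invOn g f hg hf h.symm, hne.image g, ?_⟩,
      (h.2.mono hG.subset).image_image⟩
    rw [← hdim, affineDim_image_eq g f (h.2.mono hG.subset)]

omit [TopologicalSpace E] [TopologicalSpace E'] [IsTopologicalAddGroup E']
  [ContinuousSMul ℝ E'] [T2Space E'] [IsTopologicalAddGroup E] [ContinuousSMul ℝ E] [T2Space E] in
lemma affineDim_eq_of_invOn {P : Set E} {Q : Set E'} (f : E →ᵃ[ℝ] E') (g : E' →ᵃ[ℝ] E)
    (hf : Set.MapsTo f P Q) (hg : Set.MapsTo g Q P) (h : Set.InvOn g f P Q) :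
    affineDim P = affineDim Q := by
  rw [← affineDim_image_eq f g h.1]
  congr 1
  exact Set.Subset.antisymm (hf.image_subset) fun y hy => ⟨g y, hg hy, h.2 hy⟩

end AffineTransfer

-- Full support of some point makes dim P the nullity of A itself, so the truncation in
-- `fPolynomial` loses no face.
open Polynomial in
lemma fPolynomial_nonnegSolutions {M N : Type*} [AddCommGroup N] [Module ℝ N] [Fintype M]
    {A : (M → ℝ) →ₗ[ℝ] N} {b : N} [DecidablePred (IsSupport A b)]
    (h : IsSupport A b Finset.univ) :
    fPolynomial (nonnegSolutions A b) =
      ∑ S ∈ Finset.univ.filter (IsSupport A b),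
        (X : ℤ[X]) ^ Module.finrank ℝ (coordinateKernel A S) := by
  classical
  rw [fPolynomial, ← Finset.sum_fiberwise_of_maps_to
    (t := Finset.range (affineDim (nonnegSolutions A b) + 1))
    (g := fun S => Module.finrank ℝ (coordinateKernel A S))]
  · refine Finset.sum_congr rfl fun i _ => ?_
    rw [faceNumber_nonnegSolutions, Finset.sum_congr rfl
      (g := fun _ => (X : ℤ[X]) ^ i) fun S hS => by rw [(Finset.mem_filter.mp hS).2],
      Finset.sum_const, Finset.filter_filter, nsmul_eq_mul, ← Set.ncard_coe_finset]
    simp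
  · intro S _
    rw [affineDim_nonnegSolutions h, Finset.mem_range, Nat.lt_succ_iff]
    exact Submodule.finrank_mono fun d hd => ⟨hd.1, fun m hm => absurd (Finset.mem_univ m) hm⟩

/-! ### The slack form of the polytope: supports and face dimensions. -/

/-- Indices of the slack variables of `GZ(1 2^k 3)`. -/
abbrev SlackIndex (k : ℕ) : Type := Fin k ⊕ Fin k ⊕ Fin 4

/-- A slack variable of `GZ(1 2^k 3)` as a linear form. -/
def slackCoord (k : ℕ) (m : SlackIndex k) : (SlackIndex k → ℝ) →ₗ[ℝ] ℝ :=
  LinearMap.proj m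

/-- The linear relations between the slack variables of `GZ(1 2^k 3)`. -/
noncomputable def slackSystem (k : ℕ) : (SlackIndex k → ℝ) →ₗ[ℝ] ℝ × ℝ × ℝ :=
  (∑ l, slackCoord k (Sum.inl l) + slackCoord k (Sum.inr (Sum.inr 0))).prod
    ((∑ l, slackCoord k (Sum.inr (Sum.inl l)) + slackCoord k (Sum.inr (Sum.inr 1))).prod
      (slackCoord k (Sum.inr (Sum.inr 2)) + slackCoord k (Sum.inr (Sum.inr 3)) -
        (slackCoord k (Sum.inr (Sum.inr 0)) + slackCoord k (Sum.inr (Sum.inr 1)))))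

lemma slackSystem_apply {k : ℕ} (w : SlackIndex k → ℝ) :
    slackSystem k w =
      (∑ l, w (Sum.inl l) + w (Sum.inr (Sum.inr 0)),
        ∑ l, w (Sum.inr (Sum.inl l)) + w (Sum.inr (Sum.inr 1)),
        w (Sum.inr (Sum.inr 2)) + w (Sum.inr (Sum.inr 3)) -
          (w (Sum.inr (Sum.inr 0)) + w (Sum.inr (Sum.inr 1)))) := by
  simp [slackSystem, slackCoord]

/-- The slack form of `GZ(1 2^k 3)`. -/
noncomputable abbrev slackPolytope (k : ℕ) : Set (SlackIndex k → ℝ) :=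
  nonnegSolutions (slackSystem k) (1, 1, 0)

/-- The combinatorial description of the supports of points of `slackPolytope k`. -/
def IsSlackSupport {k : ℕ} (A B : Finset (Fin k)) (D : Finset (Fin 4)) : Prop :=
  (A.Nonempty ∨ 0 ∈ D) ∧ (B.Nonempty ∨ 1 ∈ D) ∧ ((2 ∈ D ∨ 3 ∈ D) ↔ (0 ∈ D ∨ 1 ∈ D))

lemma exists_weights_of_nonempty_or {ι : Type*} [Fintype ι] [DecidableEq ι] {A : Finset ι}
    {p : Prop} [Decidable p] (h : A.Nonempty ∨ p) :
    ∃ c : ℝ, 0 < c ∧ (∑ l, if l ∈ A then c else 0) + (if p then c else 0) = 1 := by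
  have hpos : (0 : ℝ) < A.card + if p then 1 else 0 := by
    rcases h with h | h
    · have : (0 : ℝ) < A.card := by exact_mod_cast h.card_pos
      split_ifs <;> linarith
    · simp only [h, if_true]
      positivity
  refine ⟨(A.card + if p then 1 else 0)⁻¹, inv_pos.mpr hpos, ?_⟩
  rw [Finset.sum_ite_mem, Finset.univ_inter, Finset.sum_const, nsmul_eq_mul]
  rw [show (if p then ((A.card : ℝ) + if p then 1 else 0)⁻¹ else 0) =
    (if p then 1 else 0) * ((A.card : ℝ) + if p then 1 else 0)⁻¹ by split_ifs <;> simp, ← add_mul]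
  exact mul_inv_cancel₀ hpos.ne'

/-- A sum of nonnegative terms equal to 1 has a positive term, and two equal sums of nonnegative
terms are both positive or both zero. Conversely, equal weights solve the first two relations, and
the resulting total is distributed over the allowed part of {2, 3}. -/
lemma isSupport_slackSystem_iff {k : ℕ} (A B : Finset (Fin k)) (D : Finset (Fin 4)) :
    IsSupport (slackSystem k) (1, 1, 0) (A.disjSum (B.disjSum D)) ↔ IsSlackSupport A B D := by
  constructor
  · rintro ⟨w, ⟨hw0, hw⟩, hS⟩
    rw [slackSystem_apply, Prod.mk.injEq, Prod.mk.injEq] at hw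
    obtain ⟨hx, hy, hz⟩ := hw
    have hA : ∀ l, 0 < w (Sum.inl l) ↔ l ∈ A := fun l => by simp [hS]
    have hB : ∀ l, 0 < w (Sum.inr (Sum.inl l)) ↔ l ∈ B := fun l => by simp [hS]
    have hD : ∀ l, 0 < w (Sum.inr (Sum.inr l)) ↔ l ∈ D := fun l => by simp [hS]
    have h0 := hw0 (Sum.inr (Sum.inr 0))
    have h1 := hw0 (Sum.inr (Sum.inr 1))
    have h2 := hw0 (Sum.inr (Sum.inr 2))
    have h3 := hw0 (Sum.inr (Sum.inr 3))
    refine ⟨?_, ?_, ?_⟩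
    · by_contra! hcon
      have hs : ∑ l, w (Sum.inl l) = 0 := Finset.sum_eq_zero fun l _ =>
        le_antisymm (not_lt.mp fun h => by simpa [hcon.1] using (hA l).mp h) (hw0 _)
      have := mt (hD 0).mp hcon.2
      linarith
    · by_contra! hcon
      have hs : ∑ l, w (Sum.inr (Sum.inl l)) = 0 := Finset.sum_eq_zero fun l _ =>
        le_antisymm (not_lt.mp fun h => by simpa [hcon.1] using (hB l).mp h) (hw0 _)
      have := mt (hD 1).mp hcon.2
      linarith
    · rw [← hD, ← hD, ← hD, ← hD]
      constructor
      · intro h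
        by_contra! hcon
        rcases h with h | h <;> linarith
      · intro h
        by_contra! hcon
        rcases h with h | h <;> linarith
  · rintro ⟨hA, hB, hD⟩
    obtain ⟨a, ha, ha1⟩ := exists_weights_of_nonempty_or hA
    obtain ⟨b, hb, hb1⟩ := exists_weights_of_nonempty_or hB
    obtain ⟨p, q, hp, hq, hp', hq', hpq⟩ : ∃ p q : ℝ, 0 ≤ p ∧ 0 ≤ q ∧ (0 < p ↔ 2 ∈ D) ∧
        (0 < q ↔ 3 ∈ D) ∧ p + q = (if 0 ∈ D then a else 0) + (if 1 ∈ D then b else 0) := by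
      obtain ⟨t, ht⟩ : ∃ t, t = (if 0 ∈ D then a else 0) + (if 1 ∈ D then b else 0) := ⟨_, rfl⟩
      have htD : (0 < t ↔ (0 ∈ D ∨ 1 ∈ D)) ∧ 0 ≤ t := by
        rw [ht]
        by_cases h0 : 0 ∈ D <;> by_cases h1 : 1 ∈ D <;> simp [h0, h1, ha, hb, ha.le, hb.le]
        exact ⟨by positivity, by positivity⟩
      rw [← ht]
      rw [← hD] at htD
      by_cases h2 : 2 ∈ D <;> by_cases h3 : 3 ∈ D <;> simp only [h2, h3] at htD ⊢
      · have : 0 < t := htD.1.mpr (by simp)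
        exact ⟨t / 2, t / 2, by positivity, by positivity, by simp [this], by simp [this], by ring⟩
      · have : 0 < t := htD.1.mpr (by simp)
        exact ⟨t, 0, by positivity, by positivity, by simp [this], by simp, by ring⟩
      · have : 0 < t := htD.1.mpr (by simp)
        exact ⟨0, t, by positivity, by positivity, by simp, by simp [this], by ring⟩
      · have : t = 0 := le_antisymm (not_lt.mp fun h => by simpa using htD.1.mp h) htD.2
        exact ⟨0, 0, le_rfl, le_rfl, by simp, by simp, by rw [this, add_zero]⟩
    refine ⟨Sum.elim (fun l => if l ∈ A then a else 0) (Sum.elim (fun l => if l ∈ B then b else 0)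
      ![if 0 ∈ D then a else 0, if 1 ∈ D then b else 0, p, q]), ⟨?_, ?_⟩, ?_⟩
    · rintro (l | l | l)
      · simp only [Sum.elim_inl]
        split_ifs <;> linarith
      · simp only [Sum.elim_inl, Sum.elim_inr]
        split_ifs <;> linarith
      · fin_cases l
        · simp only [Sum.elim_inr]
          change (0 : ℝ) ≤ if 0 ∈ D then a else 0
          split_ifs <;> linarith
        · change (0 : ℝ) ≤ if 1 ∈ D then b else 0
          split_ifs <;> linarith
        · exact hp
        · exact hq
    · rw [slackSystem_apply, Prod.mk.injEq, Prod.mk.injEq]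
      exact ⟨ha1, hb1, sub_eq_zero.mpr hpq⟩
    · rintro (l | l | l)
      · by_cases h : l ∈ A <;> simp [h, ha]
      · by_cases h : l ∈ B <;> simp [h, hb]
      · rw [Finset.inr_mem_disjSum, Finset.inr_mem_disjSum]
        fin_cases l
        · change (0 : ℝ) < (if 0 ∈ D then a else 0) ↔ 0 ∈ D
          by_cases h : 0 ∈ D <;> simp [h, ha]
        · change (0 : ℝ) < (if 1 ∈ D then b else 0) ↔ 1 ∈ D
          by_cases h : 1 ∈ D <;> simp [h, hb]
        · exact hp'
        · exact hq'

lemma isSupport_slackSystem_univ (k : ℕ) :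
    IsSupport (slackSystem k) (1, 1, 0) Finset.univ := by
  have := (isSupport_slackSystem_iff (k := k) Finset.univ Finset.univ Finset.univ).mpr
    (by simp [IsSlackSupport])
  simpa using this

lemma exists_single_of_nonempty_or {k : ℕ} {A B : Finset (Fin k)} {D : Finset (Fin 4)}
    (h : A.Nonempty ∨ 0 ∈ D) :
    ∃ m ∈ A.disjSum (B.disjSum D), ∃ c, slackSystem k (Pi.single m 1) = (1, 0, c) := by
  rcases h with ⟨l, hl⟩ | h
  · exact ⟨Sum.inl l, by simpa, 0, by simp [slackSystem_apply, Pi.single_apply]⟩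
  · exact ⟨Sum.inr (Sum.inr 0), by simpa, -1, by simp [slackSystem_apply]⟩

lemma exists_single_of_nonempty_or' {k : ℕ} {A B : Finset (Fin k)} {D : Finset (Fin 4)}
    (h : B.Nonempty ∨ 1 ∈ D) :
    ∃ m ∈ A.disjSum (B.disjSum D), ∃ c, slackSystem k (Pi.single m 1) = (0, 1, c) := by
  rcases h with ⟨l, hl⟩ | h
  · exact ⟨Sum.inr (Sum.inl l), by simpa, 0, by simp [slackSystem_apply, Pi.single_apply]⟩
  · exact ⟨Sum.inr (Sum.inr 1), by simpa, -1, by simp [slackSystem_apply]⟩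

/-- If D meets {2, 3}, three columns indexed by the support form a triangular basis of the target.
Otherwise D is empty, the third relation reads 0 = 0, and the rank drops to 2. -/
lemma finrank_coordinateKernel_slackSystem {k : ℕ} {A B : Finset (Fin k)} {D : Finset (Fin 4)}
    (h : IsSlackSupport A B D) :
    Module.finrank ℝ (coordinateKernel (slackSystem k) (A.disjSum (B.disjSum D))) + 3 =
      A.card + B.card + D.card + if 2 ∈ D ∨ 3 ∈ D then 0 else 1 := by
  obtain ⟨hA, hB, hD⟩ := h
  obtain ⟨m₁, hm₁, c₁, h₁⟩ := exists_single_of_nonempty_or (A := A) (B := B) (D := D) hA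
  obtain ⟨m₂, hm₂, c₂, h₂⟩ := exists_single_of_nonempty_or' (A := A) (B := B) (D := D) hB
  have hcard : (A.disjSum (B.disjSum D)).card = A.card + B.card + D.card := by
    rw [Finset.card_disjSum, Finset.card_disjSum, add_assoc]
  have hne : ∀ {m n : SlackIndex k}, m ∉ A.disjSum (B.disjSum D) → n ∈ A.disjSum (B.disjSum D) →
      m ≠ n := fun hm hn h => hm (h ▸ hn)
  split_ifs with h23
  · obtain ⟨m₃, hm₃, h₃⟩ : ∃ m ∈ A.disjSum (B.disjSum D),
        slackSystem k (Pi.single m 1) = (0, 0, 1) := by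
      rcases h23 with h | h
      · exact ⟨Sum.inr (Sum.inr 2), by simpa, by simp [slackSystem_apply]⟩
      · exact ⟨Sum.inr (Sum.inr 3), by simpa, by simp [slackSystem_apply]⟩
    have := finrank_coordinateKernel_add (A := slackSystem k) (S := A.disjSum (B.disjSum D)) (by
      rintro ⟨α, β, γ⟩
      -- The last coefficient cancels the third components `c₁` and `c₂` of the first two columns.
      refine ⟨α • Pi.single m₁ 1 + β • Pi.single m₂ 1 +
        (γ - α * c₁ - β * c₂) • Pi.single m₃ 1, ?_, fun m hm => ?_⟩
      · simp only [map_add, map_smul, h₁, h₂, h₃]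
        simp
      · simp [hne hm hm₁, hne hm hm₂, hne hm hm₃])
    simp only [Module.finrank_prod, Module.finrank_self] at this
    omega
  · have hD0 : D = ∅ := by
      have h01 := mt hD.mpr h23
      rw [Finset.eq_empty_iff_forall_notMem]
      intro l
      fin_cases l <;> simp_all
    let π : ℝ × ℝ × ℝ →ₗ[ℝ] ℝ × ℝ :=
      (LinearMap.fst ℝ ℝ (ℝ × ℝ)).prod (LinearMap.fst ℝ ℝ ℝ ∘ₗ LinearMap.snd ℝ ℝ (ℝ × ℝ))
    have hker : coordinateKernel (slackSystem k) (A.disjSum (B.disjSum D)) =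
        coordinateKernel (π ∘ₗ slackSystem k) (A.disjSum (B.disjSum D)) := by
      ext d
      constructor
      · rintro ⟨h, h'⟩
        exact ⟨by rw [LinearMap.comp_apply, h, map_zero], h'⟩
      · rintro ⟨h, h'⟩
        refine ⟨?_, h'⟩
        have hd : ∀ l, d (Sum.inr (Sum.inr l)) = 0 := fun l => h' _ (by simp [hD0])
        rw [LinearMap.comp_apply, slackSystem_apply] at h
        rw [slackSystem_apply]
        have e1 : ∑ l, d (Sum.inl l) + d (Sum.inr (Sum.inr 0)) = 0 := congrArg Prod.fst h
        have e2 : ∑ l, d (Sum.inr (Sum.inl l)) + d (Sum.inr (Sum.inr 1)) = 0 :=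
          congrArg Prod.snd h
        rw [e1, e2]
        simp [hd]
    have := finrank_coordinateKernel_add (A := π ∘ₗ slackSystem k)
      (S := A.disjSum (B.disjSum D)) (by
      rintro ⟨α, β⟩
      refine ⟨α • Pi.single m₁ 1 + β • Pi.single m₂ 1, ?_, fun m hm => ?_⟩
      · simp only [map_add, map_smul, LinearMap.comp_apply, h₁, h₂]
        simp [π]
      · simp [hne hm hm₁, hne hm hm₂])
    simp only [Module.finrank_prod, Module.finrank_self] at this
    rw [hker]
    omega

/-! ### Summation over supports and the h-polynomial. -/

section Counting
open Polynomial

lemma sum_pow_card_of_nonempty_or (k : ℕ) (p : Prop) [Decidable p] :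
    ∑ A : Finset (Fin k), (if A.Nonempty ∨ p then (X : ℤ[X]) ^ A.card else 0) =
      (X + 1) ^ k - if p then 0 else 1 := by
  classical
  have h := Fin.sum_pow_mul_eq_add_pow (n := k) (X : ℤ[X]) 1
  simp only [one_pow, mul_one] at h
  rw [← h, eq_sub_iff_add_eq]
  by_cases hp : p
  · simp [hp]
  · have h1 : ∑ A : Finset (Fin k), (if A = ∅ then (1 : ℤ[X]) else 0) = 1 := by simp
    simp only [hp, or_false, if_false]
    rw [← h1, ← Finset.sum_add_distrib]
    refine Finset.sum_congr rfl fun A _ => ?_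
    rcases A.eq_empty_or_nonempty with rfl | hA
    · simp
    · simp [hA, hA.ne_empty]

lemma sum_finset_fin_four {R : Type*} [AddCommMonoid R] (f : Finset (Fin 4) → R) :
    ∑ D, f D =
      f ∅ + f {0} + f {1} + f {2} + f {3} + f {0, 1} + f {0, 2} + f {0, 3} + f {1, 2} + f
      {1, 3} + f {2, 3} + f {0, 1, 2} + f {0, 1, 3} + f {0, 2, 3} + f {1, 2, 3} + f {0, 1,
      2, 3} := by
  rw [show (Finset.univ : Finset (Finset (Fin 4))) = {
    ∅, {0}, {1}, {2}, {3}, {0, 1}, {0, 2}, {0, 3}, {1, 2}, {1, 3}, {2, 3}, {0, 1, 2}, {0,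
      1, 3}, {0, 2, 3}, {1, 2, 3}, {0, 1, 2, 3}} by decide]
  repeat rw [Finset.sum_insert (by decide)]
  rw [Finset.sum_singleton]
  ac_rfl

/-- The first summand comes from D = ∅. Otherwise D meets both {2, 3}, contributing 2X + X^2, and
{0, 1}; the last factor sums over the latter part together with A and B. -/
lemma X_pow_three_mul_fPolynomial_slackPolytope (k : ℕ) :
    X ^ 3 * fPolynomial (slackPolytope k) =
      X * ((X + 1) ^ k - 1) ^ 2 + (2 * X + X ^ 2) *
        (2 * X * (X + 1) ^ k * ((X + 1) ^ k - 1) + X ^ 2 * (X + 1) ^ (2 * k)) := by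
  classical
  have step : X ^ 3 * fPolynomial (slackPolytope k) =
      ∑ D : Finset (Fin 4), (if ((2 ∈ D ∨ 3 ∈ D) ↔ (0 ∈ D ∨ 1 ∈ D)) then
        (X : ℤ[X]) ^ (D.card + if 2 ∈ D ∨ 3 ∈ D then 0 else 1) else 0) *
        (((X + 1) ^ k - if 0 ∈ D then 0 else 1) * ((X + 1) ^ k - if 1 ∈ D then 0 else 1)) := by
    rw [fPolynomial_nonnegSolutions (isSupport_slackSystem_univ k), Finset.mul_sum,
      Finset.sum_filter, ← Finset.sumEquiv.symm.toEquiv.sum_comp, Fintype.sum_prod_type]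
    have inner : ∀ A : Finset (Fin k), ∀ g : Finset (Fin k ⊕ Fin 4) → ℤ[X],
        ∑ T, g T = ∑ B : Finset (Fin k), ∑ D, g (B.disjSum D) := fun A g => by
      rw [← Finset.sumEquiv.symm.toEquiv.sum_comp, Fintype.sum_prod_type]
      rfl
    simp_rw [inner ∅]
    -- With D outermost, the sums over A and B factor.
    rw [Finset.sum_congr rfl fun A _ => Finset.sum_comm, Finset.sum_comm]
    refine Finset.sum_congr rfl fun D _ => ?_
    rw [← sum_pow_card_of_nonempty_or, ← sum_pow_card_of_nonempty_or, Finset.sum_mul_sum,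
      Finset.mul_sum]
    refine Finset.sum_congr rfl fun A _ => ?_
    rw [Finset.mul_sum]
    refine Finset.sum_congr rfl fun B _ => ?_
    change (if IsSupport (slackSystem k) (1, 1, 0) (A.disjSum (B.disjSum D)) then
      (X : ℤ[X]) ^ 3 * X ^ Module.finrank ℝ
        (coordinateKernel (slackSystem k) (A.disjSum (B.disjSum D))) else 0) = _
    rw [isSupport_slackSystem_iff]
    by_cases h : IsSlackSupport A B D
    · rw [if_pos h, if_pos h.2.2, if_pos h.1, if_pos h.2.1, ← pow_add, ← pow_add, ← pow_add,
        add_comm 3, finrank_coordinateKernel_slackSystem h]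
      congr 1
      ring
    · rw [if_neg h]
      by_cases h1 : A.Nonempty ∨ 0 ∈ D
      · by_cases h2 : B.Nonempty ∨ 1 ∈ D
        · rw [if_neg fun h3 => h ⟨h1, h2, h3⟩, zero_mul]
        · rw [if_neg h2, mul_zero, mul_zero]
      · rw [if_neg h1, zero_mul, mul_zero]
  rw [step, sum_finset_fin_four]
  simp
  ring

/-- The components of the `h`-vector of `GZ(1 2^k 3)`. -/
def slackH (k i : ℕ) : ℤ :=
  if i ≤ k + 1 then i + 1 else if i ≤ 2 * k then 2 * k + 3 - i else if i = 2 * k + 1 then 1 else 0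

/-- Multiplication by (X - 1)^2 takes second differences, which vanish except near the ends of the
sequence and at its peak i = k + 1. -/
lemma slackH_generating (k : ℕ) (hk : 1 ≤ k) :
    (X - 1) ^ 2 * ∑ i ∈ Finset.range (2 * k + 2), C (slackH k i) * X ^ i =
      X ^ (2 * k + 3) + X ^ (2 * k + 2) - X ^ (2 * k + 1) - 2 * X ^ (k + 2) + 1 := by
  set H : ℤ[X] := ∑ i ∈ Finset.range (2 * k + 2), C (slackH k i) * X ^ i with hH
  have hc : ∀ n, H.coeff n = slackH k n := by
    intro n
    rw [hH, finsetSum_coeff]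
    simp only [coeff_C_mul, coeff_X_pow, mul_ite, mul_one, mul_zero, Finset.sum_ite_eq,
      Finset.mem_range]
    split_ifs with h
    · rfl
    · unfold slackH
      split_ifs <;> omega
  rw [show (X - 1) ^ 2 * H = H * X * X - C 2 * (H * X) + H by
    rw [show (C 2 : ℤ[X]) = 2 from rfl]; ring, show (2 : ℤ[X]) = C 2 from rfl]
  have h0 : (H * X * X - C 2 * (H * X) + H).coeff 0 = H.coeff 0 := by
    rw [coeff_add, coeff_sub, coeff_C_mul, coeff_mul_X_zero, coeff_mul_X_zero]
    ring
  have h1 : (H * X * X - C 2 * (H * X) + H).coeff 1 = H.coeff 1 - 2 * H.coeff 0 := by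
    rw [coeff_add, coeff_sub, coeff_C_mul, coeff_mul_X _ 0, coeff_mul_X _ 0, coeff_mul_X_zero]
    ring
  have h2 : ∀ n, (H * X * X - C 2 * (H * X) + H).coeff (n + 2) =
      H.coeff n - 2 * H.coeff (n + 1) + H.coeff (n + 2) := fun n => by
    rw [coeff_add, coeff_sub, coeff_C_mul, coeff_mul_X _ (n + 1), coeff_mul_X _ (n + 1),
      coeff_mul_X]
  ext n
  have hR : (X ^ (2 * k + 3) + X ^ (2 * k + 2) - X ^ (2 * k + 1) - C 2 * X ^ (k + 2) + 1 :
      ℤ[X]).coeff n = (if n = 2 * k + 3 then 1 else 0) + (if n = 2 * k + 2 then 1 else 0) -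
        (if n = 2 * k + 1 then 1 else 0) - 2 * (if n = k + 2 then 1 else 0) +
        if n = 0 then 1 else 0 := by
    rw [coeff_add, coeff_sub, coeff_sub, coeff_add, coeff_C_mul, coeff_one, coeff_X_pow,
      coeff_X_pow, coeff_X_pow, coeff_X_pow]
  rw [hR]
  rcases n with _ | _ | n
  · rw [h0, hc]
    unfold slackH
    split_ifs <;> push_cast <;> omega
  · rw [h1, hc, hc]
    unfold slackH
    split_ifs <;> push_cast <;> omega
  · rw [h2, hc, hc, hc]
    unfold slackH
    push_cast
    omega

lemma hVector_slackPolytope (k : ℕ) (hk : 1 ≤ k) (i : ℕ) :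
    hVector (slackPolytope k) i = slackH k i := by
  have h := congrArg (fun p : ℤ[X] => p.comp (X - 1)) (X_pow_three_mul_fPolynomial_slackPolytope k)
  simp only [mul_comp, add_comp, sub_comp, pow_comp, X_comp, one_comp, ofNat_comp,
    sub_add_cancel] at h
  have hX : (X - 1 : ℤ[X]) ≠ 0 := X_sub_C_ne_zero 1
  have hpoly : hPolynomial (slackPolytope k) =
      ∑ i ∈ Finset.range (2 * k + 2), C (slackH k i) * X ^ i := by
    refine mul_left_cancel₀ (pow_ne_zero 3 hX) ?_
    rw [hPolynomial, h]
    simp only [Nat.cast_ofNat]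
    -- One of the three factors X - 1 divides the closed form; `slackH_generating` accounts for the
    -- other two.
    linear_combination -(X - 1) * slackH_generating k hk
  rw [hVector, hpoly, finsetSum_coeff]
  simp only [coeff_C_mul, coeff_X_pow, mul_ite, mul_one, mul_zero, Finset.sum_ite_eq,
    Finset.mem_range]
  split_ifs with h
  · rfl
  · unfold slackH
    split_ifs <;> omega

end Counting

lemma affineDim_slackPolytope (k : ℕ) : affineDim (slackPolytope k) = 2 * k + 1 := by
  have h := finrank_coordinateKernel_slackSystem (k := k) (A := Finset.univ) (B := Finset.univ)
    (D := Finset.univ) (by simp [IsSlackSupport])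
  rw [affineDim_nonnegSolutions (isSupport_slackSystem_univ k)]
  simp at h
  exact h.trans (by omega)

/-! ### Gelfand–Tsetlin tables and their slack coordinates. -/

section GelfandTsetlin

lemma mem_gelfandTsetlin_iff {s : ℕ} {lam : Fin s → ℝ} {u : GZIndex s → ℝ} :
    u ∈ gelfandTsetlin lam ↔ ∀ (i j : ℕ) (hj : 1 ≤ j) (hij : i + 1 + j ≤ s),
      gzEntry lam u i j hj (by omega) ≤ gzEntry lam u (i + 1) j hj hij ∧
      gzEntry lam u (i + 1) j hj hij ≤ gzEntry lam u i (j + 1) (by omega) (by omega) := by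
  constructor
  · exact fun h i j hj hij => h (i + 1) j (by omega) hj hij
  · rintro h (_ | i) j hi hj hij
    · omega
    · exact h i j hj hij

lemma eq_of_gzEntry_eq {s : ℕ} {lam : Fin s → ℝ} {u v : GZIndex s → ℝ}
    (h : ∀ (i j : ℕ) (_ : 1 ≤ i) (hj : 1 ≤ j) (hij : i + j ≤ s),
      gzEntry lam u i j hj hij = gzEntry lam v i j hj hij) : u = v := by
  funext ⟨⟨i, j⟩, hi, hj, hij⟩
  have := h i j hi hj hij
  rwa [gzEntry, gzEntry, dif_neg (Nat.one_le_iff_ne_zero.mp hi),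
    dif_neg (Nat.one_le_iff_ne_zero.mp hi)] at this

/-- The entry `u_{i,1}` on the left edge of the table, with `u_{0,1} = 1`. -/
noncomputable def leftEdge (k i : ℕ) : (GZIndex (k + 2) → ℝ) →ᵃ[ℝ] ℝ :=
  if h : 1 ≤ i ∧ i ≤ k + 1 then
    (LinearMap.proj ⟨(i, 1), h.1, le_rfl, by dsimp only; omega⟩ :
      (GZIndex (k + 2) → ℝ) →ₗ[ℝ] ℝ).toAffineMap
  else AffineMap.const ℝ _ 1

/-- The entry `u_{i,k+2-i}` on the right edge of the table, with `u_{0,k+2} = 3`. -/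
noncomputable def rightEdge (k i : ℕ) : (GZIndex (k + 2) → ℝ) →ᵃ[ℝ] ℝ :=
  if h : 1 ≤ i ∧ i ≤ k + 1 then
    (LinearMap.proj ⟨(i, k + 2 - i), h.1, by dsimp only; omega, by dsimp only; omega⟩ :
      (GZIndex (k + 2) → ℝ) →ₗ[ℝ] ℝ).toAffineMap
  else AffineMap.const ℝ _ 3

lemma leftEdge_zero (k : ℕ) (u : GZIndex (k + 2) → ℝ) : leftEdge k 0 u = 1 := by
  simp [leftEdge]

lemma leftEdge_apply {k i : ℕ} (h1 : 1 ≤ i) (h2 : i ≤ k + 1) (u : GZIndex (k + 2) → ℝ)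
    (h : 1 ≤ i ∧ 1 ≤ 1 ∧ i + 1 ≤ k + 2) : leftEdge k i u = u ⟨(i, 1), h⟩ := by
  rw [leftEdge, dif_pos ⟨h1, h2⟩]
  rfl

lemma rightEdge_zero (k : ℕ) (u : GZIndex (k + 2) → ℝ) : rightEdge k 0 u = 3 := by
  simp [rightEdge]

lemma rightEdge_apply {k i j : ℕ} (h1 : 1 ≤ i) (h2 : i ≤ k + 1) (hj : i + j = k + 2)
    (u : GZIndex (k + 2) → ℝ) (h : 1 ≤ i ∧ 1 ≤ j ∧ i + j ≤ k + 2) :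
    rightEdge k i u = u ⟨(i, j), h⟩ := by
  obtain rfl : j = k + 2 - i := by omega
  rw [rightEdge, dif_pos ⟨h1, h2⟩]
  rfl

/-- The slack variables of the irredundant inequalities of `GZ(1 2^k 3)`. -/
noncomputable def slackMap (k : ℕ) : (GZIndex (k + 2) → ℝ) →ᵃ[ℝ] (SlackIndex k → ℝ) :=
  AffineMap.pi (Sum.elim (fun l => leftEdge k (l + 1) - leftEdge k l)
    (Sum.elim (fun l => rightEdge k l - rightEdge k (l + 1))
      ![AffineMap.const ℝ _ 2 - leftEdge k k, rightEdge k k - AffineMap.const ℝ _ 2,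
        leftEdge k (k + 1) - leftEdge k k, rightEdge k k - leftEdge k (k + 1)]))

lemma slackMap_inl {k : ℕ} (u : GZIndex (k + 2) → ℝ) (l : Fin k) :
    slackMap k u (Sum.inl l) = leftEdge k (l + 1) u - leftEdge k l u := rfl

lemma slackMap_inr_inl {k : ℕ} (u : GZIndex (k + 2) → ℝ) (l : Fin k) :
    slackMap k u (Sum.inr (Sum.inl l)) = rightEdge k l u - rightEdge k (l + 1) u := rfl

lemma slackMap_zero {k : ℕ} (u : GZIndex (k + 2) → ℝ) :
    slackMap k u (Sum.inr (Sum.inr 0)) = 2 - leftEdge k k u := rfl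

lemma slackMap_one {k : ℕ} (u : GZIndex (k + 2) → ℝ) :
    slackMap k u (Sum.inr (Sum.inr 1)) = rightEdge k k u - 2 := rfl

lemma slackMap_two {k : ℕ} (u : GZIndex (k + 2) → ℝ) :
    slackMap k u (Sum.inr (Sum.inr 2)) = leftEdge k (k + 1) u - leftEdge k k u := rfl

lemma slackMap_three {k : ℕ} (u : GZIndex (k + 2) → ℝ) :
    slackMap k u (Sum.inr (Sum.inr 3)) = rightEdge k k u - leftEdge k (k + 1) u := rfl

/-- The sum of the first `i` slack variables along one edge of the table. -/
noncomputable def partialSum {k : ℕ} (e : Fin k → SlackIndex k) (i : ℕ) :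
    (SlackIndex k → ℝ) →ₗ[ℝ] ℝ :=
  ∑ l ∈ Finset.range i, if h : l < k then slackCoord k (e ⟨l, h⟩) else 0

section PartialSum

variable {k : ℕ} (e : Fin k → SlackIndex k) (w : SlackIndex k → ℝ)

lemma partialSum_zero : partialSum e 0 w = 0 := rfl

lemma partialSum_succ {i : ℕ} (hi : i < k) :
    partialSum e (i + 1) w = partialSum e i w + w (e ⟨i, hi⟩) := by
  rw [partialSum, Finset.sum_range_succ, dif_pos hi]
  rfl

lemma partialSum_eq_sum : partialSum e k w = ∑ l, w (e l) := by
  rw [partialSum, ← Fin.sum_univ_eq_sum_range fun l =>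
    if h : l < k then slackCoord k (e ⟨l, h⟩) else 0]
  simp [slackCoord]

lemma partialSum_mono (hw : ∀ m, 0 ≤ w m) {i j : ℕ} (hij : i ≤ j) :
    partialSum e i w ≤ partialSum e j w := by
  simp only [partialSum, LinearMap.sum_apply]
  refine Finset.sum_le_sum_of_subset_of_nonneg (Finset.range_mono hij) fun l _ _ => ?_
  split_ifs
  · exact hw _
  · exact le_rfl

end PartialSum

/-- The entries of the table with prescribed slack variables, including those of the top row. -/
noncomputable def tableEntry (k i j : ℕ) : (SlackIndex k → ℝ) →ᵃ[ℝ] ℝ :=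
  -- The bottom entry (k+1, 1) lies on both edges; testing j = 1 first computes it from the left
  -- chain.
  if j = 1 then
    if i ≤ k then (partialSum Sum.inl i).toAffineMap + AffineMap.const ℝ _ 1
    else (partialSum Sum.inl k + slackCoord k (Sum.inr (Sum.inr 2))).toAffineMap +
      AffineMap.const ℝ _ 1
  else if i + j = k + 2 then
    AffineMap.const ℝ _ 3 - (partialSum (Sum.inr ∘ Sum.inl) i).toAffineMap
  else AffineMap.const ℝ _ 2

lemma tableEntry_apply (k i j : ℕ) (w : SlackIndex k → ℝ) :
    tableEntry k i j w =
      if j = 1 then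
        if i ≤ k then partialSum Sum.inl i w + 1
        else partialSum Sum.inl k w + w (Sum.inr (Sum.inr 2)) + 1
      else if i + j = k + 2 then 3 - partialSum (Sum.inr ∘ Sum.inl) i w else 2 := by
  unfold tableEntry
  split_ifs <;> rfl

/-- The table with prescribed slack variables. -/
noncomputable def tableMap (k : ℕ) : (SlackIndex k → ℝ) →ᵃ[ℝ] (GZIndex (k + 2) → ℝ) :=
  AffineMap.pi fun p => tableEntry k p.1.1 p.1.2

lemma gzEntry_tableMap {k : ℕ} (w : SlackIndex k → ℝ) (i j : ℕ) (hj : 1 ≤ j)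
    (hij : i + j ≤ k + 2) :
    gzEntry (seqOneTwosThree k) (tableMap k w) i j hj hij = tableEntry k i j w := by
  unfold gzEntry
  split_ifs with hi
  · subst hi
    rw [tableEntry_apply]
    simp only [seqOneTwosThree, Fin.ext_iff, Fin.val_zero, Fin.val_last, partialSum_zero]
    split_ifs <;> first | omega | norm_num
  · rfl

/-- By induction on the row, both upper neighbours of an entry off the edges equal 2. -/
lemma gzEntry_eq_two {k : ℕ} {u : GZIndex (k + 2) → ℝ}
    (hu : u ∈ gelfandTsetlin (seqOneTwosThree k)) (i : ℕ) :
    ∀ j (hj : 2 ≤ j) (hij : i + j ≤ k + 1),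
      gzEntry (seqOneTwosThree k) u i j (by omega) (by omega) = 2 := by
  induction i with
  | zero =>
    intro j hj hij
    simp only [gzEntry, dif_pos, seqOneTwosThree, Fin.ext_iff, Fin.val_zero, Fin.val_last]
    rw [if_neg (by omega), if_neg (by omega)]
  | succ i ih =>
    intro j hj hij
    have h := mem_gelfandTsetlin_iff.mp hu i j (by omega) (by omega)
    rw [ih j hj (by omega), ih (j + 1) (by omega) (by omega)] at h
    exact le_antisymm h.2 h.1

lemma gzEntry_left {k : ℕ} (u : GZIndex (k + 2) → ℝ) (i : ℕ) (hi : i + 1 ≤ k + 2) :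
    gzEntry (seqOneTwosThree k) u i 1 le_rfl hi = leftEdge k i u := by
  unfold gzEntry
  split_ifs with h
  · subst h
    rw [leftEdge_zero]
    simp [seqOneTwosThree]
  · rw [leftEdge_apply (by omega) (by omega)]

lemma gzEntry_right {k : ℕ} (u : GZIndex (k + 2) → ℝ) (i j : ℕ) (hj : 1 ≤ j)
    (hij : i + j = k + 2) :
    gzEntry (seqOneTwosThree k) u i j hj hij.le = rightEdge k i u := by
  unfold gzEntry
  split_ifs with h
  · subst h
    obtain rfl : j = k + 2 := by omega
    rw [rightEdge_zero]
    simp [seqOneTwosThree, Fin.ext_iff]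
  · rw [rightEdge_apply (by omega) (by omega) hij]

variable {k : ℕ} {u : GZIndex (k + 2) → ℝ}

lemma leftEdge_le_succ (hu : u ∈ gelfandTsetlin (seqOneTwosThree k)) {i : ℕ} (hi : i ≤ k) :
    leftEdge k i u ≤ leftEdge k (i + 1) u := by
  have h := (mem_gelfandTsetlin_iff.mp hu i 1 le_rfl (by omega)).1
  rwa [gzEntry_left, gzEntry_left] at h

lemma rightEdge_succ_le (hu : u ∈ gelfandTsetlin (seqOneTwosThree k)) {i : ℕ} (hi : i ≤ k) :
    rightEdge k (i + 1) u ≤ rightEdge k i u := by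
  have h := (mem_gelfandTsetlin_iff.mp hu i (k + 1 - i) (by omega) (by omega)).2
  rwa [gzEntry_right _ _ _ _ (by omega), gzEntry_right _ _ _ _ (by omega)] at h

lemma leftEdge_le_two (hk : 1 ≤ k) (hu : u ∈ gelfandTsetlin (seqOneTwosThree k)) :
    leftEdge k k u ≤ 2 := by
  obtain ⟨n, rfl⟩ : ∃ n, k = n + 1 := ⟨k - 1, by omega⟩
  -- The upper right neighbour of (k, 1) is (k-1, 2), an entry equal to 2.
  have h := (mem_gelfandTsetlin_iff.mp hu n 1 le_rfl (by omega)).2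
  rwa [gzEntry_left, gzEntry_eq_two hu _ _ (by omega) (by omega)] at h

lemma two_le_rightEdge (hk : 1 ≤ k) (hu : u ∈ gelfandTsetlin (seqOneTwosThree k)) :
    2 ≤ rightEdge k k u := by
  obtain ⟨n, rfl⟩ : ∃ n, k = n + 1 := ⟨k - 1, by omega⟩
  have h := (mem_gelfandTsetlin_iff.mp hu n 2 (by omega) (by omega)).1
  rwa [gzEntry_eq_two hu _ _ (by omega) (by omega), gzEntry_right _ _ _ _ (by omega)] at h

lemma rightEdge_last : rightEdge k (k + 1) u = leftEdge k (k + 1) u := by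
  rw [rightEdge_apply (j := 1) (by omega) (by omega) (by omega) u ⟨by omega, le_rfl, by omega⟩,
    leftEdge_apply (by omega) (by omega)]

lemma partialSum_slackMap_left {i : ℕ} (hi : i ≤ k) :
    partialSum Sum.inl i (slackMap k u) = leftEdge k i u - 1 := by
  induction i with
  | zero => rw [partialSum_zero, leftEdge_zero, sub_self]
  | succ i ih =>
    rw [partialSum_succ _ _ hi, ih (by omega), slackMap_inl]
    ring

lemma partialSum_slackMap_right {i : ℕ} (hi : i ≤ k) :
    partialSum (Sum.inr ∘ Sum.inl) i (slackMap k u) = 3 - rightEdge k i u := by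
  induction i with
  | zero => rw [partialSum_zero, rightEdge_zero, sub_self]
  | succ i ih =>
    rw [partialSum_succ _ _ hi, ih (by omega), Function.comp_apply, slackMap_inr_inl]
    ring

lemma mapsTo_slackMap (hk : 1 ≤ k) :
    Set.MapsTo (slackMap k) (gelfandTsetlin (seqOneTwosThree k)) (slackPolytope k) := by
  intro u hu
  refine ⟨?_, ?_⟩
  · rintro (l | l | l)
    · rw [slackMap_inl]
      linarith [leftEdge_le_succ hu l.2.le]
    · rw [slackMap_inr_inl]
      linarith [rightEdge_succ_le hu l.2.le]
    · fin_cases l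
      · exact sub_nonneg.mpr (leftEdge_le_two hk hu)
      · exact sub_nonneg.mpr (two_le_rightEdge hk hu)
      · exact sub_nonneg.mpr (leftEdge_le_succ hu le_rfl)
      · have h := rightEdge_succ_le hu le_rfl
        rw [rightEdge_last] at h
        exact sub_nonneg.mpr h
  · have h1 := partialSum_slackMap_left (u := u) (le_refl k)
    have h2 := partialSum_slackMap_right (u := u) (le_refl k)
    rw [partialSum_eq_sum] at h1 h2
    simp only [Function.comp_apply] at h2
    rw [slackSystem_apply, h1, h2, slackMap_zero, slackMap_one, slackMap_two, slackMap_three]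
    refine Prod.ext ?_ (Prod.ext ?_ ?_) <;> dsimp only <;> ring

lemma mapsTo_tableMap :
    Set.MapsTo (tableMap k) (slackPolytope k) (gelfandTsetlin (seqOneTwosThree k)) := by
  rintro w ⟨hw, hA⟩
  rw [slackSystem_apply, Prod.mk.injEq, Prod.mk.injEq] at hA
  obtain ⟨hx, hy, hz⟩ := hA
  have hX := partialSum_eq_sum (k := k) Sum.inl w
  have hY := partialSum_eq_sum (k := k) (Sum.inr ∘ Sum.inl) w
  simp only [Function.comp_apply] at hY
  have hXm := fun i j h => partialSum_mono (k := k) Sum.inl w hw (i := i) (j := j) h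
  have hYm := fun i j h => partialSum_mono (k := k) (Sum.inr ∘ Sum.inl) w hw (i := i) (j := j) h
  have h0 := hw (Sum.inr (Sum.inr 0))
  have h1 := hw (Sum.inr (Sum.inr 1))
  have h2 := hw (Sum.inr (Sum.inr 2))
  have h3 := hw (Sum.inr (Sum.inr 3))
  refine mem_gelfandTsetlin_iff.mpr fun i j hj hij => ?_
  rw [gzEntry_tableMap, gzEntry_tableMap, gzEntry_tableMap]
  simp only [tableEntry_apply]
  by_cases hj1 : j = 1
  · subst hj1
    rw [if_pos rfl, if_pos rfl, if_pos (show i ≤ k by omega), if_neg (show ¬1 + 1 = 1 by omega)]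
    by_cases hik : i + 1 ≤ k
    · rw [if_pos hik, if_neg (show ¬i + (1 + 1) = k + 2 by omega)]
      have := hXm i (i + 1) (by omega)
      have := hXm (i + 1) k hik
      exact ⟨by linarith, by linarith⟩
    · obtain rfl : i = k := by omega
      rw [if_neg hik, if_pos (show i + (1 + 1) = i + 2 by omega)]
      exact ⟨by linarith, by linarith⟩
  · rw [if_neg hj1, if_neg hj1, if_neg (show ¬i + j = k + 2 by omega),
      if_neg (show ¬j + 1 = 1 by omega)]
    by_cases hij' : i + 1 + j = k + 2
    · rw [if_pos hij', if_pos (show i + (j + 1) = k + 2 by omega)]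
      have := hYm i (i + 1) (by omega)
      have := hYm (i + 1) k (by omega)
      exact ⟨by linarith, by linarith⟩
    · rw [if_neg hij', if_neg (show ¬i + (j + 1) = k + 2 by omega)]
      exact ⟨le_rfl, le_rfl⟩

lemma tableMap_slackMap (hu : u ∈ gelfandTsetlin (seqOneTwosThree k)) :
    tableMap k (slackMap k u) = u := by
  refine eq_of_gzEntry_eq (lam := seqOneTwosThree k) fun i j hi hj hij => ?_
  rw [gzEntry_tableMap, tableEntry_apply]
  split_ifs with h1 h2 h2
  · subst h1
    rw [partialSum_slackMap_left h2, gzEntry_left]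
    ring
  · subst h1
    obtain rfl : i = k + 1 := by omega
    rw [partialSum_slackMap_left le_rfl, slackMap_two, gzEntry_left]
    ring
  · rw [partialSum_slackMap_right (by omega), gzEntry_right _ _ _ _ h2]
    ring
  · exact (gzEntry_eq_two hu i j (by omega) (by omega)).symm

lemma leftEdge_tableMap (w : SlackIndex k → ℝ) {i : ℕ} (hi : i ≤ k + 1) :
    leftEdge k i (tableMap k w) = tableEntry k i 1 w := by
  rw [← gzEntry_left _ _ (by omega), gzEntry_tableMap]

lemma rightEdge_tableMap (w : SlackIndex k → ℝ) {i : ℕ} (hi : i ≤ k) :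
    rightEdge k i (tableMap k w) = tableEntry k i (k + 2 - i) w := by
  rw [← gzEntry_right _ _ (k + 2 - i) (by omega) (by omega), gzEntry_tableMap]

/-- The table is built from x, y and c alone; a, b and d are recovered from the three linear
relations. -/
lemma slackMap_tableMap {w : SlackIndex k → ℝ} (hw : w ∈ slackPolytope k) :
    slackMap k (tableMap k w) = w := by
  obtain ⟨-, hA⟩ := hw
  rw [slackSystem_apply, Prod.mk.injEq, Prod.mk.injEq] at hA
  obtain ⟨hx, hy, hz⟩ := hA
  have hX := partialSum_eq_sum (k := k) Sum.inl w
  have hY := partialSum_eq_sum (k := k) (Sum.inr ∘ Sum.inl) w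
  simp only [Function.comp_apply] at hY
  have hl : ∀ i ≤ k, leftEdge k i (tableMap k w) = partialSum Sum.inl i w + 1 := fun i hi => by
    rw [leftEdge_tableMap w (by omega), tableEntry_apply, if_pos rfl, if_pos hi]
  have hl' : leftEdge k (k + 1) (tableMap k w) =
      partialSum Sum.inl k w + w (Sum.inr (Sum.inr 2)) + 1 := by
    rw [leftEdge_tableMap w le_rfl, tableEntry_apply, if_pos rfl, if_neg (by omega)]
  have hr : ∀ i ≤ k, rightEdge k i (tableMap k w) =
      3 - partialSum (Sum.inr ∘ Sum.inl) i w := fun i hi => by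
    rw [rightEdge_tableMap w hi, tableEntry_apply, if_neg (by omega), if_pos (by omega)]
  funext m
  rcases m with l | l | l
  · rw [slackMap_inl, hl _ l.2, hl _ l.2.le, partialSum_succ _ _ l.2]
    ring
  · rw [slackMap_inr_inl, hr _ l.2, hr _ l.2.le, partialSum_succ _ _ l.2, Function.comp_apply]
    ring
  · fin_cases l
    · change slackMap k _ (Sum.inr (Sum.inr 0)) = w (Sum.inr (Sum.inr 0))
      rw [slackMap_zero, hl k le_rfl]
      linarith
    · change slackMap k _ (Sum.inr (Sum.inr 1)) = w (Sum.inr (Sum.inr 1))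
      rw [slackMap_one, hr k le_rfl]
      linarith
    · change slackMap k _ (Sum.inr (Sum.inr 2)) = w (Sum.inr (Sum.inr 2))
      rw [slackMap_two, hl k le_rfl, hl']
      ring
    · change slackMap k _ (Sum.inr (Sum.inr 3)) = w (Sum.inr (Sum.inr 3))
      rw [slackMap_three, hr k le_rfl, hl']
      linarith

lemma invOn_tableMap_slackMap (k : ℕ) :
    Set.InvOn (tableMap k) (slackMap k) (gelfandTsetlin (seqOneTwosThree k)) (slackPolytope k) :=
  ⟨fun _ hu => tableMap_slackMap hu, fun _ hw => slackMap_tableMap hw⟩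

end GelfandTsetlin

theorem mainTheorem2 (k : ℕ) (hk : 1 ≤ k) :
    affineDim (gelfandTsetlin (seqOneTwosThree k)) = 2 * k + 1 ∧
    hVector (gelfandTsetlin (seqOneTwosThree k)) (2 * k + 1) = 1 ∧
    (∀ i : ℕ, i ≤ k + 1 →
      hVector (gelfandTsetlin (seqOneTwosThree k)) i = (i : ℤ) + 1) ∧
    (∀ i : ℕ, k + 1 < i → i ≤ 2 * k →
      hVector (gelfandTsetlin (seqOneTwosThree k)) i = 2 * (k : ℤ) + 3 - (i : ℤ)) := by
  have hdim : affineDim (gelfandTsetlin (seqOneTwosThree k)) = affineDim (slackPolytope k) :=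
    affineDim_eq_of_invOn _ _ (mapsTo_slackMap hk) mapsTo_tableMap (invOn_tableMap_slackMap k)
  have hf : fPolynomial (gelfandTsetlin (seqOneTwosThree k)) = fPolynomial (slackPolytope k) := by
    unfold fPolynomial
    rw [hdim]
    refine Finset.sum_congr rfl fun i _ => ?_
    rw [faceNumber_eq_of_invOn _ _ (mapsTo_slackMap hk) mapsTo_tableMap
      (invOn_tableMap_slackMap k)]
  have hh : ∀ i, hVector (gelfandTsetlin (seqOneTwosThree k)) i = slackH k i := fun i => by
    rw [← hVector_slackPolytope k hk, hVector, hVector, hPolynomial, hPolynomial, hf]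
  refine ⟨hdim.trans (affineDim_slackPolytope k), ?_, fun i hi => ?_, fun i hi hi' => ?_⟩
  · rw [hh, slackH, if_neg (by omega), if_neg (by omega), if_pos rfl]
  · rw [hh, slackH, if_pos hi]
  · rw [hh, slackH, if_neg (by omega), if_pos hi']
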